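/- Let $1<p,q<\infty$ with $\frac1p+\frac1q=1$. Let $\Gamma$ be (the vertex set of) a tree with root $a$ in which every vertex has finitely many children, and $\Gamma^*=\Gamma\setminus\{a\}$. Write $s\preceq t$ if the path from $t$ to $a$ passes through $s$, and let $t_p$ denote the parent of $t\neq a$. Let $u=\{u_t\}_{t\in\Gamma^*}$, $v=\{v_t\}_{t\in\Gamma^*}$ be positive weights. We say that the Hardy inequality holds with constant $C\in[0,\infty)$ if for every real family $b=\{b_t\}_{t\in\Gamma^*}$ with $bv^{-1}\in\ell^q(\Gamma^*)$ all the sums $\sum_{s\succeq t}b_s$, $t\in\Gamma^*$, converge (unconditionally) and $$\Big(\sum_{t\in\Gamma^*}\Big|u_t^{-1}\sum_{s\succeq t}b_s\Big|^q\Big)^{1/q}\le C\Big(\sum_{t\in\Gamma^*}|b_tv_t^{-1}|^q\Big)^{1/q}.$$ For a subtree $K$ (a set of vertices whose induced graph is a tree) let $\partial K=\{s\in K:\ \exists t,\ t_p=s,\ t\notin K\}$, and let $\mathcal K$ be the class of all subtrees $K$ of $\Gamma$ such that $a\in K$ and, whenever $s\in\partial K$, no $t\succ s$ belongs to $K$.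 For $D\subseteq\Gamma$ put $$\alpha_D=\inf\Big\{\|b\|_{\ell^p(\Gamma^*)}:\ \sum_{a\prec s\preceq t}|b_s|u_s^{-1}=1\ \ \forall t\in D\Big\},\qquad \inf\emptyset=\infty,$$ and, for $D\subseteq K$, $Q(K,D)=\|v\|_{\ell^p(\Gamma^*\setminus (K\setminus D))}/\alpha_D\in[0,\infty]$, with $0/0=0$ and $x/\infty=0$ for all $x\in[0,\infty]$. A leaf is a vertex without children. Define $$B=\sup_{K\in\mathcal K}Q(K,\partial K),\qquad \widetilde B=\sup\{Q(K,\partial K\cup L):\ K\in\mathcal K,\ L\subseteq K \text{ a set of leaves of } \Gamma\}.$$ (1) The Hardy inequality holds with some constant $C<\infty$ if and only if $\widetilde B<\infty$. In that case there is a smallest admissible constant $C$, and $\widetilde B\le C\le 4\widetilde B$. (2) If $\Gamma$ has no leaves, then the Hardy inequality holds with some constant $C<\infty$ if and only if $B=\sup_{K\in\mathcal K}\|v\|_{\ell^p(\Gamma^*\setminus K^\circ)}/\alpha_{\partial K}<\infty$, where $K^\circ=K\setminus\partial K$. In that case there is a smallest admissible constant $C$, and $B\le C\le 4B$. -/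

import Mathlib

open scoped ENNReal NNReal

namespace TreeHardy

noncomputable section

/-- The `ℓ^p` norm of a family of real numbers, with value `∞` if the family is not in `ℓ^p`. -/
def eNorm {ι : Type*} (p : ℝ) (b : ι → ℝ) : ℝ≥0∞ :=
  (∑' i, ‖b i‖ₑ ^ p) ^ (1 / p)

variable {V : Type*}

/-- The order of a tree `G` rooted at `a`: the (unique) path connecting `t` to the root `a`
passes through `s`. -/
def Le (G : SimpleGraph V) (a s t : V) : Prop :=
  ∃ w : G.Walk t a, w.IsPath ∧ s ∈ w.support

/-- The strict order of the tree. -/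
def Lt (G : SimpleGraph V) (a s t : V) : Prop :=
  Le G a s t ∧ s ≠ t

/-- `s` is the parent of `t`: the vertex joined to `t` by an edge on the path to the root. -/
def IsParent (G : SimpleGraph V) (a s t : V) : Prop :=
  G.Adj s t ∧ Le G a s t

/-- A leaf of the rooted tree: a vertex that has no children. -/
def IsLeaf (G : SimpleGraph V) (a s : V) : Prop :=
  ∀ t, ¬ IsParent G a s t

/-- The set of vertices different from the root. -/
abbrev Star (a : V) : Type _ := {t : V // t ≠ a}

/-- The weighted Hardy inequality with constant `C`. The convergence of the inner sums is part of
the claim. -/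
def HardyWith (G : SimpleGraph V) (a : V) (q : ℝ) (u v : Star a → ℝ) (C : ℝ≥0) : Prop :=
  ∀ b : Star a → ℝ, eNorm q (fun t => b t * (v t)⁻¹) < ∞ →
    (∀ t : Star a, Summable fun s : {s : Star a // Le G a t s} => b s) ∧
    eNorm q (fun t : Star a => (u t)⁻¹ * ∑' s : {s : Star a // Le G a t s}, b s) ≤
      C * eNorm q (fun t => b t * (v t)⁻¹)

/-- The boundary of a set `K` of vertices: the elements of `K` with a child outside `K`. -/
def boundary (G : SimpleGraph V) (a : V) (K : Set V) : Set V :=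
  {s | s ∈ K ∧ ∃ t, IsParent G a s t ∧ t ∉ K}

/-- The subtrees that contain the root and all of whose boundary points are maximal. A subtree is
given by its set of vertices. -/
def maxSubtrees (G : SimpleGraph V) (a : V) : Set (Set V) :=
  {K | (G.induce K).IsTree ∧ a ∈ K ∧ ∀ s ∈ boundary G a K, ∀ t, Lt G a s t → t ∉ K}

/-- The infimum of `‖b‖_p` over all `b` with `∑_{a ≺ s ⪯ t} |b_s| u_s⁻¹ = 1` for all `t ∈ D`
(the infimum of the empty set is `∞`). -/
def alpha (G : SimpleGraph V) (a : V) (p : ℝ) (u : Star a → ℝ) (D : Set V) : ℝ≥0∞ :=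
  ⨅ b ∈ {b : Star a → ℝ |
      ∀ t ∈ D, ∑' s : {s : Star a // Le G a s t}, |b s| * (u s)⁻¹ = 1},
    eNorm p b

/-- The quotient `‖v‖_{ℓ^p(Γ ∖ (K ∖ D))} / α_D`, with `0 / 0 = 0` and `x / ∞ = 0`. -/
def ratio (G : SimpleGraph V) (a : V) (p : ℝ) (u v : Star a → ℝ) (K D : Set V) : ℝ≥0∞ :=
  eNorm p (fun t : {t : Star a // (t : V) ∉ K \ D} => v t) / alpha G a p u D

/-- The supremum of the quotients over all subtrees in the class, with their boundaries. -/
def constB (G : SimpleGraph V) (a : V) (p : ℝ) (u v : Star a → ℝ) : ℝ≥0∞ :=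
  ⨆ K ∈ maxSubtrees G a, ratio G a p u v K (boundary G a K)

/-- The same supremum where, besides, any set `L` of leaves of the whole tree that lie in `K` may
be counted as boundary points of `K`. If the tree has no leaves, then `L = ∅`. -/
def constBLeaf (G : SimpleGraph V) (a : V) (p : ℝ) (u v : Star a → ℝ) : ℝ≥0∞ :=
  ⨆ K ∈ maxSubtrees G a, ⨆ L ∈ {L : Set V | L ⊆ K ∧ ∀ s ∈ L, IsLeaf G a s},
    ratio G a p u v K (boundary G a K ∪ L)

end

end TreeHardy

/-!
The Hardy inequality says that `c ↦ (u_t⁻¹ ∑_{s ⪰ t} v_s c_s)_t` is bounded by `C` on `ℓ^q`. Its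
kernel is nonnegative, so by duality (`lpNorm_transpose_le`, `hardyWith_iff_pathSumBound`) this is
the same as the bound `‖v F‖_p ≤ C ‖f‖_p` for all `f ≥ 0`, where
`F(t) = ∑_{a ≺ s ⪯ t} f_s u_s⁻¹` is the sum along the path from `t` to the root.

*Lower bound* (`ratio_le_of_pathSumBound`). If `b` is admissible for `α_D` and `D` contains the
boundary of `K`, then the path from any vertex off `K ∖ D` to the root meets `D`, so the path sum of
`|b| u⁻¹` is at least `1` there. Hence `‖v‖ ≤ C ‖b‖` off `K ∖ D`, and `Q(K, D) ≤ C`.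

*Upper bound* (`pathSumBound_of_constBLeaf`). For a level `c > 0`, the vertices all of whose proper
predecessors satisfy `F < c` form a subtree `K` of the class; the boundary points of `K` and the
leaves in `K` where `F ≥ c` are the vertices where `F` first reaches `c`, and removing
the rest of `K` leaves exactly `{F ≥ c}` (`exists_maxSubtree_level`). The increments of `F`,
truncated to the values between `c / 2` and `c` and divided by `c / 2`, are admissible for `α`, so
that `‖v‖_{ℓ^p(F ≥ c)}` is controlled by `u` times these truncated increments
(`tsum_level_le`). Taking `c = 2 ^ k`, multiplying by the bound `2 ^ (k + 1)` for `F` on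
`{2 ^ k ≤ F < 2 ^ (k + 1)}` and summing the `p`-th powers over `k ∈ ℤ` gives the constant
`2 ^ (k + 1) / 2 ^ (k - 1) = 4`: the truncated increments at a vertex `s` add up to at most the
whole increment `f_s u_s⁻¹` (`tsum_enorm_slab_le`), and a sum of `p`-th powers is at most the `p`-th
power of the sum.

The admissible constants form a closed set, which yields a smallest one. In a tree without leaves
the only set of leaves is empty, so the two suprema coincide.
-/

open scoped ENNReal NNReal

namespace TreeHardy

noncomputable section

/-! ### Norms and duality in `ℓ^p` -/

/-- The `ℓ^p` norm of a family with values in `[0, ∞]`. -/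
def lpNorm {ι : Type*} (p : ℝ) (f : ι → ℝ≥0∞) : ℝ≥0∞ :=
  (∑' i, f i ^ p) ^ (1 / p)

theorem eNorm_eq_lpNorm {ι : Type*} (p : ℝ) (b : ι → ℝ) :
    eNorm p b = lpNorm p fun i => ‖b i‖ₑ := rfl

theorem lpNorm_mono {ι : Type*} {p : ℝ} (hp : 0 < p) {f g : ι → ℝ≥0∞} (h : ∀ i, f i ≤ g i) :
    lpNorm p f ≤ lpNorm p g := by
  unfold lpNorm
  gcongr with i
  exact h i

theorem lpNorm_rpow {ι : Type*} {p : ℝ} (hp : 0 < p) (f : ι → ℝ≥0∞) :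
    lpNorm p f ^ p = ∑' i, f i ^ p := by
  rw [lpNorm, ← ENNReal.rpow_mul, one_div_mul_cancel hp.ne', ENNReal.rpow_one]

theorem lpNorm_const_mul {ι : Type*} {p : ℝ} (hp : 0 < p) (c : ℝ≥0∞) (f : ι → ℝ≥0∞) :
    lpNorm p (fun i => c * f i) = c * lpNorm p f := by
  simp only [lpNorm, ENNReal.mul_rpow_of_nonneg _ _ hp.le, ENNReal.tsum_mul_left]
  rw [ENNReal.mul_rpow_of_nonneg _ _ (by positivity), ← ENNReal.rpow_mul,
    mul_one_div_cancel hp.ne', ENNReal.rpow_one]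

theorem le_lpNorm {ι : Type*} {p : ℝ} (hp : 0 < p) (f : ι → ℝ≥0∞) (i : ι) : f i ≤ lpNorm p f := by
  calc f i = (f i ^ p) ^ (1 / p) := by
        rw [← ENNReal.rpow_mul, mul_one_div_cancel hp.ne', ENNReal.rpow_one]
    _ ≤ lpNorm p f := by
        unfold lpNorm
        gcongr
        exact ENNReal.le_tsum (f := fun i => f i ^ p) i

theorem enorm_tsum_of_nonneg {ι : Type*} {f : ι → ℝ} (h0 : ∀ i, 0 ≤ f i) (hf : Summable f) :
    ‖∑' i, f i‖ₑ = ∑' i, ‖f i‖ₑ := by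
  rw [Real.enorm_of_nonneg (tsum_nonneg h0), ENNReal.ofReal_tsum_of_nonneg h0 hf]
  exact tsum_congr fun i => (Real.enorm_of_nonneg (h0 i)).symm

theorem tsum_mul_le_lpNorm_mul_lpNorm {ι : Type*} {p q : ℝ} (hpq : p.HolderConjugate q)
    (f g : ι → ℝ≥0∞) : ∑' i, f i * g i ≤ lpNorm p f * lpNorm q g := by
  have hp := hpq.one_div_nonneg
  have hq := hpq.symm.one_div_nonneg
  rw [ENNReal.tsum_eq_iSup_sum]
  refine iSup_le fun s => (ENNReal.inner_le_Lp_mul_Lq s f g hpq).trans ?_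
  unfold lpNorm
  gcongr <;> exact ENNReal.sum_le_tsum s

/-- The converse of Hölder's inequality. It suffices to test with finite-valued `f`. -/
theorem lpNorm_le_of_forall_pairing_le {ι : Type*} {p q : ℝ} (hpq : p.HolderConjugate q)
    {g : ι → ℝ≥0∞} {M : ℝ≥0∞}
    (h : ∀ f : ι → ℝ≥0, lpNorm p (fun i => (f i : ℝ≥0∞)) ≠ ∞ →
      ∑' i, f i * g i ≤ M * lpNorm p fun i => (f i : ℝ≥0∞)) :
    lpNorm q g ≤ M := by
  classical
  have hp := hpq.pos
  have hq := hpq.symm.pos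
  rcases eq_or_ne M ∞ with rfl | hM
  · exact le_top
  have hg : ∀ i, g i ≠ ∞ := by
    intro i
    have h1 : lpNorm p (fun j => ((Pi.single i 1 : ι → ℝ≥0) j : ℝ≥0∞)) = 1 := by
      rw [lpNorm, tsum_eq_single i fun j hj => by simp [Pi.single_eq_of_ne hj, hp]]
      simp
    have h2 := h (Pi.single i 1) (by rw [h1]; simp)
    rw [h1, mul_one, tsum_eq_single i fun j hj => by simp [Pi.single_eq_of_ne hj]] at h2
    exact ne_top_of_le_ne_top hM (by simpa using h2)
  have key : ∀ s : Finset ι, ∑ i ∈ s, g i ^ q ≤ M ^ q := by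
    intro s
    -- Equality in Hölder's inequality is attained for `f = g ^ (q - 1)`.
    let f : ι → ℝ≥0 := fun i => if i ∈ s then (g i).toNNReal ^ (q - 1) else 0
    have hf : ∀ i ∈ s, (f i : ℝ≥0∞) = g i ^ (q - 1) := by
      intro i hi
      simp only [f, if_pos hi]
      rw [ENNReal.coe_rpow_of_nonneg _ hpq.symm.sub_one_pos.le, ENNReal.coe_toNNReal (hg i)]
    have hf0 : ∀ i ∉ s, (f i : ℝ≥0∞) = 0 := fun i hi => by simp [f, hi]
    have hX : ∑ i ∈ s, g i ^ q ≠ ∞ :=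
      ENNReal.sum_ne_top.2 fun i _ => ENNReal.rpow_ne_top_of_nonneg hq.le (hg i)
    have hN : lpNorm p (fun i => (f i : ℝ≥0∞)) = (∑ i ∈ s, g i ^ q) ^ (1 / p) := by
      rw [lpNorm, tsum_eq_sum (s := s) fun i hi => by simp [hf0 i hi, hp]]
      congr 1
      refine Finset.sum_congr rfl fun i hi => ?_
      rw [hf i hi, ← ENNReal.rpow_mul, hpq.symm.sub_one_mul_conj]
    have h1 := h f (by rw [hN]; exact ENNReal.rpow_ne_top_of_nonneg hpq.one_div_nonneg hX)
    rw [hN, tsum_eq_sum (s := s) fun i hi => by simp [hf0 i hi]] at h1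
    have h2 : ∑ i ∈ s, (f i : ℝ≥0∞) * g i = ∑ i ∈ s, g i ^ q := by
      refine Finset.sum_congr rfl fun i hi => ?_
      rw [hf i hi]
      nth_rewrite 2 [← ENNReal.rpow_one (g i)]
      rw [← ENNReal.rpow_add_of_nonneg _ _ hpq.symm.sub_one_pos.le zero_le_one, sub_add_cancel]
    rw [h2] at h1
    set X := ∑ i ∈ s, g i ^ q
    rcases eq_or_ne X 0 with h0 | h0
    · rw [h0]; exact zero_le
    have hr0 : X ^ (1 / p) ≠ 0 := by simp [h0, hX]
    have hr1 : X ^ (1 / p) ≠ ∞ := ENNReal.rpow_ne_top_of_nonneg hpq.one_div_nonneg hX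
    have h3 : X = X ^ (1 / q) * X ^ (1 / p) := by
      rw [← ENNReal.rpow_add _ _ h0 hX, one_div, one_div, hpq.symm.inv_add_inv_eq_one,
        ENNReal.rpow_one]
    have h4 : X ^ (1 / q) ≤ M := by
      exact (ENNReal.mul_le_mul_iff_left hr0 hr1).1 (h3 ▸ h1)
    calc X = (X ^ (1 / q)) ^ q := by
          rw [← ENNReal.rpow_mul, one_div_mul_cancel hq.ne', ENNReal.rpow_one]
      _ ≤ M ^ q := by gcongr
  calc lpNorm q g ≤ (M ^ q) ^ (1 / q) := by
        unfold lpNorm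
        gcongr
        rw [ENNReal.tsum_eq_iSup_sum]
        exact iSup_le key
    _ = M := by rw [← ENNReal.rpow_mul, mul_one_div_cancel hq.ne', ENNReal.rpow_one]

/-- A kernel operator and its transpose have the same norm on the dual `ℓ^p` spaces. -/
theorem lpNorm_transpose_le {ι κ : Type*} {p q : ℝ} (hpq : p.HolderConjugate q)
    {A : ι → κ → ℝ≥0∞} {C : ℝ≥0∞}
    (h : ∀ f : κ → ℝ≥0, lpNorm p (fun j => (f j : ℝ≥0∞)) ≠ ∞ →
      lpNorm p (fun i => ∑' j, A i j * f j) ≤ C * lpNorm p fun j => (f j : ℝ≥0∞))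
    (g : ι → ℝ≥0∞) :
    lpNorm q (fun j => ∑' i, A i j * g i) ≤ C * lpNorm q g := by
  refine lpNorm_le_of_forall_pairing_le hpq fun f hf => ?_
  calc ∑' j, (f j : ℝ≥0∞) * ∑' i, A i j * g i
      = ∑' j, ∑' i, (A i j * f j) * g i := by
        refine tsum_congr fun j => ?_
        rw [← ENNReal.tsum_mul_left]
        exact tsum_congr fun i => by ring
    _ = ∑' i, (∑' j, A i j * f j) * g i := by
        rw [ENNReal.tsum_comm]
        exact tsum_congr fun i => ENNReal.tsum_mul_right
    _ ≤ lpNorm p (fun i => ∑' j, A i j * f j) * lpNorm q g :=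
        tsum_mul_le_lpNorm_mul_lpNorm hpq _ _
    _ ≤ C * lpNorm p (fun j => (f j : ℝ≥0∞)) * lpNorm q g := by gcongr; exact h f hf
    _ = _ := by ring

theorem tsum_rpow_le_rpow_tsum {ι : Type*} {p : ℝ} (hp : 1 ≤ p) (x : ι → ℝ≥0∞) :
    ∑' i, x i ^ p ≤ (∑' i, x i) ^ p := by
  have split : ∀ y : ℝ≥0∞, y ^ p = y * y ^ (p - 1) := by
    intro y
    nth_rewrite 2 [← ENNReal.rpow_one y]
    rw [← ENNReal.rpow_add_of_nonneg _ _ zero_le_one (sub_nonneg.2 hp), add_sub_cancel]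
  rw [split (∑' i, x i), ← ENNReal.tsum_mul_right]
  refine ENNReal.tsum_le_tsum fun i => ?_
  rw [split]
  gcongr
  exact ENNReal.le_tsum i

/-! ### Paths to the root -/

section Tree

variable {V : Type*} {G : SimpleGraph V} {a : V}

theorem le_iff_mem_support (hG : G.IsTree) {s t : V} {w : G.Walk t a} (hw : w.IsPath) :
    Le G a s t ↔ s ∈ w.support := by
  refine ⟨?_, fun h => ⟨w, hw, h⟩⟩
  rintro ⟨w', hw', h⟩
  rwa [(hG.existsUnique_path t a).unique hw hw']

theorem Le.refl (hG : G.IsTree) (t : V) : Le G a t t := by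
  obtain ⟨w, hw, -⟩ := hG.existsUnique_path t a
  exact ⟨w, hw, w.start_mem_support⟩

theorem le_root_iff (hG : G.IsTree) {s : V} : Le G a s a ↔ s = a := by
  rw [le_iff_mem_support hG (SimpleGraph.Walk.IsPath.nil (u := a))]
  simp

/-- The path from `t` to the root starts with the step from `t` to its parent. -/
theorem IsParent.exists_path (hG : G.IsTree) {r t : V} (h : IsParent G a r t) :
    ∃ w : G.Walk r a, (SimpleGraph.Walk.cons h.1.symm w).IsPath := by
  classical
  obtain ⟨hadj, w, hw, hr⟩ := h
  have hedge : (SimpleGraph.Walk.cons hadj.symm SimpleGraph.Walk.nil).IsPath := by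
    simp [SimpleGraph.Walk.cons_isPath_iff, hadj.ne']
  have h1 := (hG.existsUnique_path t r).unique (hw.takeUntil hr) hedge
  refine ⟨w.dropUntil r hr, ?_⟩
  have h2 := w.take_spec hr
  rw [h1] at h2
  simp only [SimpleGraph.Walk.cons_append, SimpleGraph.Walk.nil_append] at h2
  rwa [h2]

theorem IsParent.ne_root (hG : G.IsTree) {r t : V} (h : IsParent G a r t) : t ≠ a := by
  rintro rfl
  exact h.1.ne ((le_root_iff hG).1 h.2)

theorem IsParent.le_iff (hG : G.IsTree) {r t : V} (h : IsParent G a r t) {s : V} :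
    Le G a s t ↔ s = t ∨ Le G a s r := by
  obtain ⟨w, hw⟩ := h.exists_path hG
  rw [le_iff_mem_support hG hw,
    le_iff_mem_support hG ((SimpleGraph.Walk.cons_isPath_iff _ _).1 hw).1]
  simp

theorem IsParent.not_le (hG : G.IsTree) {r t : V} (h : IsParent G a r t) : ¬ Le G a t r := by
  obtain ⟨w, hw⟩ := h.exists_path hG
  rw [SimpleGraph.Walk.cons_isPath_iff] at hw
  rw [le_iff_mem_support hG hw.1]
  exact hw.2

theorem IsParent.unique (hG : G.IsTree) {r r' t : V} (h : IsParent G a r t)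
    (h' : IsParent G a r' t) : r = r' := by
  obtain ⟨w, hw⟩ := h.exists_path hG
  obtain ⟨w', hw'⟩ := h'.exists_path hG
  simpa using congrArg SimpleGraph.Walk.snd ((hG.existsUnique_path t a).unique hw hw')

theorem exists_isParent (hG : G.IsTree) {t : V} (ht : t ≠ a) : ∃ r, IsParent G a r t := by
  obtain ⟨w, hw, -⟩ := hG.existsUnique_path t a
  cases w with
  | nil => exact absurd rfl ht
  | cons h w => exact ⟨_, h.symm, _, hw, by simp⟩

/-- The parent of a vertex; the root is its own parent by convention. -/
def parent (G : SimpleGraph V) (a t : V) : V :=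
  open Classical in if h : ∃ r, IsParent G a r t then h.choose else a

theorem isParent_parent (hG : G.IsTree) {t : V} (ht : t ≠ a) : IsParent G a (parent G a t) t := by
  have h := exists_isParent hG ht
  rw [parent, dif_pos h]
  exact h.choose_spec

theorem IsParent.parent_eq (hG : G.IsTree) {r t : V} (h : IsParent G a r t) :
    parent G a t = r :=
  (isParent_parent hG (h.ne_root hG)).unique hG h

/-- Induction along the tree, from the root to the children. -/
theorem induction_parent (hG : G.IsTree) {P : V → Prop} (root : P a)
    (child : ∀ t, t ≠ a → P (parent G a t) → P t) (t : V) : P t := by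
  have main : ∀ (n : ℕ) (t : V) (w : G.Walk t a), w.IsPath → w.length = n → P t := by
    intro n
    induction n with
    | zero =>
      intro t w _ hn
      rwa [SimpleGraph.Walk.eq_of_length_eq_zero hn]
    | succ n ih =>
      intro t w hw hn
      cases w with
      | nil => exact root
      | cons h w =>
        have hp : IsParent G a _ t := ⟨h.symm, _, hw, by simp⟩
        refine child t (hp.ne_root hG) ?_
        rw [hp.parent_eq hG]
        exact ih _ w ((SimpleGraph.Walk.cons_isPath_iff _ _).1 hw).1 (by simpa using hn)
  obtain ⟨w, hw, -⟩ := hG.existsUnique_path t a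
  exact main _ t w hw rfl

theorem Le.trans (hG : G.IsTree) {r s t : V} (hrs : Le G a r s) : Le G a s t → Le G a r t := by
  induction t using induction_parent (a := a) hG with
  | root =>
    intro h
    rwa [(le_root_iff hG).1 h] at hrs
  | child t ht ih =>
    intro h
    rcases ((isParent_parent hG ht).le_iff hG).1 h with rfl | h
    · exact hrs
    · exact ((isParent_parent hG ht).le_iff hG).2 (Or.inr (ih h))

theorem finite_setOf_le (hG : G.IsTree) (t : V) : {s : Star a | Le G a s t}.Finite := by
  obtain ⟨w, hw, -⟩ := hG.existsUnique_path t a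
  refine Set.Finite.of_finite_image (f := Subtype.val) (w.support.finite_toSet.subset ?_)
    Subtype.val_injective.injOn
  rintro _ ⟨s, hs, rfl⟩
  exact (le_iff_mem_support hG hw).1 hs

/-- The sum of `g` over the vertices of the path from `t` to the root, without the root. -/
def pathSum (G : SimpleGraph V) (a : V) (g : Star a → ℝ) (t : V) : ℝ :=
  ∑' s : {s : Star a // Le G a s t}, g s

theorem pathSum_root (hG : G.IsTree) (g : Star a → ℝ) : pathSum G a g a = 0 := by
  have : IsEmpty {s : Star a // Le G a s a} := ⟨fun s => s.1.2 ((le_root_iff hG).1 s.2)⟩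
  simp [pathSum]

theorem pathSum_eq_add (hG : G.IsTree) (g : Star a → ℝ) {t : V} (ht : t ≠ a) :
    pathSum G a g t = pathSum G a g (parent G a t) + g ⟨t, ht⟩ := by
  classical
  have h (r : V) : pathSum G a g r = ∑ s ∈ (finite_setOf_le hG r).toFinset, g s := by
    rw [pathSum, ← Finset.tsum_subtype]
    exact (Equiv.subtypeEquivRight
      (p := fun s : Star a => Le G a s r) (q := (· ∈ (finite_setOf_le hG r).toFinset))
      fun s => by simp).tsum_eq fun s => g s.1
  have hins : (finite_setOf_le hG t).toFinset =
      insert ⟨t, ht⟩ (finite_setOf_le hG (parent G a t)).toFinset := by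
    ext s
    simp [(isParent_parent hG ht).le_iff hG, Subtype.ext_iff]
  rw [h, h, hins, Finset.sum_insert, add_comm]
  simpa using (isParent_parent hG ht).not_le hG

theorem pathSum_sub_parent (hG : G.IsTree) {φ : V → ℝ} (h0 : φ a = 0) (t : V) :
    pathSum G a (fun s => φ s - φ (parent G a s)) t = φ t := by
  induction t using induction_parent (a := a) hG with
  | root => rw [pathSum_root hG, h0]
  | child t ht ih => rw [pathSum_eq_add hG _ ht, ih]; ring

theorem pathSum_mono (hG : G.IsTree) {g : Star a → ℝ} (hg : ∀ s, 0 ≤ g s) {s t : V} :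
    Le G a s t → pathSum G a g s ≤ pathSum G a g t := by
  induction t using induction_parent (a := a) hG with
  | root =>
    intro h
    rw [(le_root_iff hG).1 h]
  | child t ht ih =>
    intro h
    rcases ((isParent_parent hG ht).le_iff hG).1 h with rfl | h
    · exact le_rfl
    · rw [pathSum_eq_add hG _ ht]
      linarith [ih h, hg ⟨t, ht⟩]

theorem pathSum_nonneg {g : Star a → ℝ} (hg : ∀ s, 0 ≤ g s) (t : V) : 0 ≤ pathSum G a g t :=
  tsum_nonneg fun s => hg s

/-- The path from a vertex outside `K` to the root enters `K` in a boundary point. -/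
theorem exists_mem_boundary_le (hG : G.IsTree) {K : Set V} (ha : a ∈ K) {t : V} :
    t ∉ K → ∃ s ∈ boundary G a K, Le G a s t := by
  induction t using induction_parent (a := a) hG with
  | root => exact fun h => absurd ha h
  | child t ht ih =>
    intro h
    have hp := isParent_parent hG ht
    by_cases hK : parent G a t ∈ K
    · exact ⟨_, ⟨hK, t, hp, h⟩, hp.2⟩
    · obtain ⟨s, hs, hle⟩ := ih hK
      exact ⟨s, hs, Le.trans hG hle hp.2⟩

theorem isTree_induce (hG : G.IsTree) {K : Set V} (ha : a ∈ K)
    (hK : ∀ t ∈ K, t ≠ a → parent G a t ∈ K) : (G.induce K).IsTree := by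
  refine ⟨?_, hG.isAcyclic.induce K⟩
  rw [SimpleGraph.connected_iff_exists_forall_reachable]
  refine ⟨⟨a, ha⟩, ?_⟩
  rintro ⟨t, ht⟩
  induction t using induction_parent (a := a) hG with
  | root => exact SimpleGraph.Reachable.rfl
  | child t hta ih =>
    exact (ih (hK t ht hta)).trans
      (SimpleGraph.Adj.reachable (by simpa using (isParent_parent hG hta).1))

end Tree

/-! ### The dual form of the Hardy inequality -/

section Duality

variable {V : Type*} {G : SimpleGraph V} {a : V} {p q : ℝ} {u v : Star a → ℝ}

/-- The inequality dual to the Hardy inequality: the operator that sums `f u⁻¹` along the path to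
the root and multiplies by `v` is bounded by `C` on the nonnegative families in `ℓ^p`. -/
def PathSumBound (G : SimpleGraph V) (a : V) (p : ℝ) (u v : Star a → ℝ) (C : ℝ≥0∞) : Prop :=
  ∀ f : Star a → ℝ, (∀ s, 0 ≤ f s) → eNorm p f ≠ ∞ →
    eNorm p (fun t : Star a => v t * pathSum G a (fun s => f s * (u s)⁻¹) t) ≤ C * eNorm p f

/-- The kernel `v_t u_s⁻¹`, for `s` on the path from `t` to the root, whose row sums give the path
sums and whose column sums give the sums in the Hardy inequality. -/
def hardyKernel (G : SimpleGraph V) (a : V) (u v : Star a → ℝ) (t s : Star a) : ℝ≥0∞ :=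
  open Classical in if Le G a s t then ‖v t‖ₑ * ‖(u s)⁻¹‖ₑ else 0

theorem tsum_hardyKernel_row (f : Star a → ℝ) (t : Star a) :
    ∑' s, hardyKernel G a u v t s * ‖f s‖ₑ =
      ‖v t‖ₑ * ∑' s : {s : Star a // Le G a s t}, ‖f s * (u s)⁻¹‖ₑ := by
  classical
  rw [← ENNReal.tsum_mul_left]
  refine Eq.trans ?_ (tsum_subtype {s : Star a | Le G a s t}
    fun s => ‖v t‖ₑ * ‖f s * (u s)⁻¹‖ₑ).symm
  refine tsum_congr fun s => ?_
  by_cases h : Le G a s t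
  · simp only [hardyKernel, Set.indicator, Set.mem_ofPred_eq, h, if_true, enorm_mul]
    ring
  · simp [hardyKernel, Set.indicator, h]

theorem tsum_hardyKernel_column (hv : ∀ t, 0 < v t) (b : Star a → ℝ) (s : Star a) :
    ∑' t, hardyKernel G a u v t s * ‖b t * (v t)⁻¹‖ₑ =
      ‖(u s)⁻¹‖ₑ * ∑' t : {t : Star a // Le G a s t}, ‖b t‖ₑ := by
  classical
  rw [← ENNReal.tsum_mul_left]
  refine Eq.trans ?_ (tsum_subtype {t : Star a | Le G a s t}
    fun t => ‖(u s)⁻¹‖ₑ * ‖b t‖ₑ).symm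
  refine tsum_congr fun t => ?_
  by_cases h : Le G a s t
  · simp only [hardyKernel, Set.indicator, Set.mem_ofPred_eq, h, if_true]
    have hb : ‖b t‖ₑ = ‖v t‖ₑ * ‖b t * (v t)⁻¹‖ₑ := by
      rw [← enorm_mul, mul_comm, inv_mul_cancel_right₀ (hv t).ne']
    rw [hb]
    ring
  · simp [hardyKernel, Set.indicator, h]

theorem enorm_mul_pathSum (hG : G.IsTree) (hu : ∀ t, 0 < u t) {f : Star a → ℝ}
    (hf : ∀ s, 0 ≤ f s) (t : Star a) :
    ‖v t * pathSum G a (fun s => f s * (u s)⁻¹) t‖ₑ =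
      ∑' s, hardyKernel G a u v t s * ‖f s‖ₑ := by
  have : Finite {s : Star a // Le G a s t} := finite_setOf_le hG (t : V)
  rw [tsum_hardyKernel_row, enorm_mul, pathSum, enorm_tsum_of_nonneg]
  · exact fun s => mul_nonneg (hf s) (inv_nonneg.2 (hu s).le)
  · exact Summable.of_finite

theorem pathSumBound_of_hardyWith (hG : G.IsTree) (hpq : p.HolderConjugate q)
    (hu : ∀ t, 0 < u t) (hv : ∀ t, 0 < v t) {C : ℝ≥0} (h : HardyWith G a q u v C) :
    PathSumBound G a p u v C := by
  intro f hf _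
  simp only [eNorm_eq_lpNorm, enorm_mul_pathSum hG hu hf]
  refine lpNorm_transpose_le hpq.symm (A := fun s t => hardyKernel G a u v t s) ?_ _
  intro g hg
  have hb (t : Star a) : ‖v t * (g t : ℝ) * (v t)⁻¹‖ₑ = g t := by
    rw [mul_comm (v t), mul_inv_cancel_right₀ (hv t).ne']
    simp
  have hN : eNorm q (fun t : Star a => v t * (g t : ℝ) * (v t)⁻¹) =
      lpNorm q fun t => (g t : ℝ≥0∞) := by
    simp only [eNorm_eq_lpNorm, hb]
  obtain ⟨hsum, hle⟩ := h (fun t => v t * (g t : ℝ)) (by rw [hN]; exact hg.lt_top)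
  rw [hN, eNorm_eq_lpNorm] at hle
  convert hle using 3 with s
  rw [enorm_mul,
    enorm_tsum_of_nonneg (f := fun t : {t : Star a // Le G a s t} => v t * (g t : ℝ))
      (fun t => mul_nonneg (hv t).le (g t).2) (hsum s),
    ← tsum_hardyKernel_column hv (fun t => v t * (g t : ℝ))]
  simp only [hb]

theorem hardyWith_of_pathSumBound (hG : G.IsTree) (hpq : p.HolderConjugate q)
    (hu : ∀ t, 0 < u t) (hv : ∀ t, 0 < v t) {C : ℝ≥0} (h : PathSumBound G a p u v C) :
    HardyWith G a q u v C := by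
  intro b hb
  have key : lpNorm q (fun s : Star a =>
      ‖(u s)⁻¹‖ₑ * ∑' t : {t : Star a // Le G a s t}, ‖b t‖ₑ) ≤
        C * eNorm q (fun t => b t * (v t)⁻¹) := by
    simp only [← tsum_hardyKernel_column hv]
    refine lpNorm_transpose_le hpq (A := hardyKernel G a u v) ?_ _
    intro f hf
    have hN : eNorm p (fun s => (f s : ℝ)) = lpNorm p fun s => (f s : ℝ≥0∞) := by
      simp [eNorm_eq_lpNorm]
    have h1 := h (fun s => (f s : ℝ)) (fun s => (f s).2) (by rwa [hN])
    rw [hN, eNorm_eq_lpNorm] at h1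
    simp only [enorm_mul_pathSum (f := fun s => (f s : ℝ)) hG hu fun s => (f s).2] at h1
    simpa using h1
  have hsum (s : Star a) : ∑' t : {t : Star a // Le G a s t}, ‖b t‖ₑ ≠ ∞ := by
    intro htop
    have h1 := (le_lpNorm hpq.symm.pos _ s).trans key
    rw [htop, ENNReal.mul_top (by simpa using (hu s).ne'), top_le_iff] at h1
    exact ENNReal.mul_ne_top ENNReal.coe_ne_top hb.ne h1
  refine ⟨fun s => Summable.of_enorm (hsum s), le_trans ?_ key⟩
  rw [eNorm_eq_lpNorm]
  refine lpNorm_mono hpq.symm.pos fun s => ?_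
  rw [enorm_mul]
  gcongr
  exact enorm_tsum_le_tsum_enorm

theorem hardyWith_iff_pathSumBound (hG : G.IsTree) (hpq : p.HolderConjugate q)
    (hu : ∀ t, 0 < u t) (hv : ∀ t, 0 < v t) {C : ℝ≥0} :
    HardyWith G a q u v C ↔ PathSumBound G a p u v C :=
  ⟨pathSumBound_of_hardyWith hG hpq hu hv, hardyWith_of_pathSumBound hG hpq hu hv⟩

end Duality

/-! ### The lower bound for the best constant -/

section Bounds

variable {V : Type*} {G : SimpleGraph V} {a : V} {p q : ℝ} {u v : Star a → ℝ}

/-- If `b` is admissible in the definition of `α_D`, then its path sums are at least `1` off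
`K ∖ D`, so `b` bounds the `ℓ^p` norm of `v` there. -/
theorem eNorm_compl_le (hG : G.IsTree) (hp : 0 < p) (hu : ∀ t, 0 < u t) {C : ℝ≥0∞}
    (h : PathSumBound G a p u v C) {K D : Set V} (ha : a ∈ K) (hD : boundary G a K ⊆ D)
    {b : Star a → ℝ} (hb : ∀ t ∈ D, pathSum G a (fun s => |b s| * (u s)⁻¹) t = 1)
    (hfin : eNorm p b ≠ ∞) :
    eNorm p (fun t : {t : Star a // (t : V) ∉ K \ D} => v t) ≤ C * eNorm p b := by
  have habs : eNorm p (fun s => |b s|) = eNorm p b := by simp [eNorm]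
  have h1 := h (fun s => |b s|) (fun s => abs_nonneg _) (by rwa [habs])
  rw [habs] at h1
  refine le_trans ?_ h1
  have hmem (t : {t : Star a // (t : V) ∉ K \ D}) : ∃ s ∈ D, Le G a s (t : Star a) := by
    by_cases hK : ((t : Star a) : V) ∈ K
    · exact ⟨_, by_contra fun hD => t.2 ⟨hK, hD⟩, Le.refl hG _⟩
    · obtain ⟨s, hs, hle⟩ := exists_mem_boundary_le hG ha hK
      exact ⟨s, hD hs, hle⟩
  have hpt (t : {t : Star a // (t : V) ∉ K \ D}) :
      ‖v t‖ₑ ≤ ‖v t * pathSum G a (fun s => |b s| * (u s)⁻¹) (t : Star a)‖ₑ := by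
    obtain ⟨s, hs, hle⟩ := hmem t
    have h2 : 1 ≤ pathSum G a (fun s => |b s| * (u s)⁻¹) (t : Star a) := by
      rw [← hb s hs]
      exact pathSum_mono hG (fun s => mul_nonneg (abs_nonneg _) (inv_nonneg.2 (hu s).le)) hle
    rw [enorm_mul, Real.enorm_of_nonneg (zero_le_one.trans h2)]
    exact le_mul_of_one_le_right' (by simpa using h2)
  unfold eNorm
  gcongr
  refine (ENNReal.tsum_le_tsum fun t => ENNReal.rpow_le_rpow (hpt t) hp.le).trans ?_
  exact ENNReal.tsum_comp_le_tsum_of_injective Subtype.val_injective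
    fun t : Star a => ‖v t * pathSum G a (fun s => |b s| * (u s)⁻¹) t‖ₑ ^ p

theorem ratio_le_of_pathSumBound (hG : G.IsTree) (hp : 0 < p) (hu : ∀ t, 0 < u t) {C : ℝ≥0}
    (h : PathSumBound G a p u v C) {K D : Set V} (ha : a ∈ K) (hD : boundary G a K ⊆ D) :
    ratio G a p u v K D ≤ C := by
  unfold ratio
  set x := eNorm p (fun t : {t : Star a // (t : V) ∉ K \ D} => v t)
  rcases eq_or_ne (alpha G a p u D) ∞ with htop | htop
  · simp [htop]
  have hx : ∀ b : Star a → ℝ, (∀ t ∈ D, pathSum G a (fun s => |b s| * (u s)⁻¹) t = 1) →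
      eNorm p b ≠ ∞ → x ≤ C * eNorm p b :=
    fun b hb hfin => eNorm_compl_le hG hp hu h ha hD hb hfin
  refine ENNReal.div_le_of_le_mul ?_
  -- For `C = 0` the product `C * ‖b‖_p` bounds `x` only if `‖b‖_p` is finite.
  rcases eq_or_ne C 0 with rfl | hC
  · have hlt : alpha G a p u D < ∞ := htop.lt_top
    simp only [alpha, iInf_lt_iff] at hlt
    obtain ⟨b, hb, hfin⟩ := hlt
    simpa using hx b hb hfin.ne
  · have hC' : (C : ℝ≥0∞) ≠ 0 := by simpa using hC
    rw [mul_comm, ← ENNReal.div_le_iff hC' ENNReal.coe_ne_top]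
    refine le_iInf₂ fun b hb => ?_
    rcases eq_or_ne (eNorm p b) ∞ with hfin | hfin
    · rw [hfin]; exact le_top
    · rw [ENNReal.div_le_iff' hC' ENNReal.coe_ne_top]
      exact hx b hb hfin

theorem constBLeaf_le_of_pathSumBound (hG : G.IsTree) (hp : 0 < p) (hu : ∀ t, 0 < u t) {C : ℝ≥0}
    (h : PathSumBound G a p u v C) : constBLeaf G a p u v ≤ C :=
  iSup₂_le fun _ hK => iSup₂_le fun _ _ =>
    ratio_le_of_pathSumBound hG hp hu h hK.2.1 Set.subset_union_left

/-! ### Level sets of path sums and the upper bound -/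

/-- For a function `F` increasing away from the root, the vertices all of whose proper predecessors
lie in `{F < c}` form a subtree `K` of the class. Its boundary points and the leaves where
`F ≥ c` are together the vertices where `F` first reaches the level `c`. -/
theorem exists_maxSubtree_level (hG : G.IsTree) {F : V → ℝ}
    (hF : ∀ s t, Le G a s t → F s ≤ F t) {c : ℝ} (hc : F a < c) :
    ∃ K ∈ maxSubtrees G a, ∃ L ∈ {L : Set V | L ⊆ K ∧ ∀ s ∈ L, IsLeaf G a s},
      (∀ t ∈ boundary G a K ∪ L, c ≤ F t) ∧
      ∀ t, c ≤ F t → t ∉ K \ (boundary G a K ∪ L) := by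
  let K : Set V := {t | t = a ∨ F (parent G a t) < c}
  have hK {t : V} : t ∉ K ↔ t ≠ a ∧ c ≤ F (parent G a t) := by simp [K]
  have hbd {s : V} (hs : s ∈ boundary G a K) : c ≤ F s := by
    obtain ⟨-, t, hst, ht⟩ := hs
    rw [← hst.parent_eq hG]
    exact (hK.1 ht).2
  refine ⟨K, ⟨?_, Or.inl rfl, ?_⟩, {s | s ∈ K ∧ IsLeaf G a s ∧ c ≤ F s},
    ⟨fun s hs => hs.1, fun s hs => hs.2.1⟩, ?_, ?_⟩
  · refine isTree_induce hG (Or.inl rfl) fun t ht hta => ?_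
    by_contra hpar
    obtain ⟨hne, hle⟩ := hK.1 hpar
    exact hK.2 ⟨hta, hle.trans (hF _ _ (isParent_parent hG hne).2)⟩ ht
  · rintro s hs t ⟨hle, hne⟩
    have hta : t ≠ a := by
      rintro rfl
      exact hne ((le_root_iff hG).1 hle)
    have hle' := (((isParent_parent hG hta).le_iff hG).1 hle).resolve_left hne
    exact hK.2 ⟨hta, (hbd hs).trans (hF _ _ hle')⟩
  · rintro t (ht | ht)
    exacts [hbd ht, ht.2.2]
  · rintro t hct ⟨htK, ht⟩
    simp only [Set.mem_union, not_or] at ht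
    refine ht.2 ⟨htK, fun r hr => ht.1 ⟨htK, r, hr, ?_⟩, hct⟩
    exact hK.2 ⟨hr.ne_root hG, by rwa [hr.parent_eq hG]⟩

/-- The length of the part of the interval from `x` to `y`, for `x ≤ y`, that lies between `c / 2` and `c`. -/
def slab (c x y : ℝ) : ℝ :=
  (min y c - min y (c / 2)) - (min x c - min x (c / 2))

theorem slab_nonneg {c x y : ℝ} (hc : 0 < c) (h : x ≤ y) : 0 ≤ slab c x y := by
  unfold slab
  rcases min_cases x c with h1 | h1 <;> rcases min_cases y c with h2 | h2 <;>
    rcases min_cases x (c / 2) with h3 | h3 <;> rcases min_cases y (c / 2) with h4 | h4 <;>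
    linarith

/-- The dyadic slabs are disjoint parts of the interval from `x` to `y`. -/
theorem tsum_enorm_slab_le {x y : ℝ} (hxy : x ≤ y) :
    ∑' k : ℤ, ‖slab (2 ^ k) x y‖ₑ ≤ ENNReal.ofReal (y - x) := by
  have hmono : ∀ {m n : ℤ}, m ≤ n →
      min y ((2 : ℝ) ^ m) - min x (2 ^ m) ≤ min y (2 ^ n) - min x (2 ^ n) := by
    intro m n hmn
    have h2 : (2 : ℝ) ^ m ≤ 2 ^ n := zpow_le_zpow_right₀ one_le_two hmn
    rcases min_cases x ((2 : ℝ) ^ m) with h1 | h1 <;>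
      rcases min_cases y ((2 : ℝ) ^ m) with h2 | h2 <;>
      rcases min_cases x ((2 : ℝ) ^ n) with h3 | h3 <;>
      rcases min_cases y ((2 : ℝ) ^ n) with h4 | h4 <;> linarith
  have hle : ∀ n : ℤ, min y ((2 : ℝ) ^ n) - min x (2 ^ n) ≤ y - x := by
    intro n
    rcases min_cases x ((2 : ℝ) ^ n) with h3 | h3 <;>
      rcases min_cases y ((2 : ℝ) ^ n) with h4 | h4 <;> linarith
  -- The sum over slabs below the level `2 ^ n` telescopes.
  have hsum : ∀ (S : Finset ℤ) (n : ℤ), (∀ k ∈ S, k ≤ n) →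
      ∑ k ∈ S, slab (2 ^ k) x y ≤ min y ((2 : ℝ) ^ n) - min x (2 ^ n) := by
    intro S
    induction S using Finset.induction_on_max with
    | empty =>
      intro n _
      simpa using min_le_min_right _ hxy
    | insert m S hS ih =>
      intro n hn
      rw [Finset.sum_insert fun hm => lt_irrefl m (hS m hm)]
      have h1 := ih (m - 1) fun k hk => by have := hS k hk; omega
      have h2 := hmono (hn m (Finset.mem_insert_self _ _))
      have h3 : (2 : ℝ) ^ m / 2 = 2 ^ (m - 1) := by rw [zpow_sub_one₀ two_ne_zero]; rfl
      rw [slab, h3]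
      linarith
  rw [ENNReal.tsum_eq_iSup_sum]
  refine iSup_le fun S => ?_
  have h0 : ∀ k : ℤ, 0 ≤ slab (2 ^ k) x y := fun k => slab_nonneg (by positivity) hxy
  simp only [Real.enorm_of_nonneg (h0 _)]
  rw [← ENNReal.ofReal_sum_of_nonneg fun k _ => h0 k]
  refine ENNReal.ofReal_le_ofReal ?_
  obtain ⟨n, hn⟩ := S.exists_le
  exact (hsum S n hn).trans (hle n)

/-- The weak-type estimate on `{F ≥ c}`. The family `b` that is admissible for the subtree of level
`c` is the increment of `F` truncated to the values between `c / 2` and `c`. Its norm is assumed finite because the right-hand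
side would otherwise be `0` when the supremum vanishes. -/
theorem tsum_level_le (hG : G.IsTree) (hp : 0 < p) (hu : ∀ t, 0 < u t)
    (hB : constBLeaf G a p u v < ∞) {F : V → ℝ} (hF : ∀ s t, Le G a s t → F s ≤ F t)
    (hFa : F a = 0) {c : ℝ} (hc : 0 < c)
    (hfin : eNorm p (fun s : Star a =>
      u s * (slab c (F (parent G a s)) (F s) / (c / 2))) ≠ ∞) :
    eNorm p (fun t : {t : Star a // c ≤ F t} => v t) ≤
      constBLeaf G a p u v *
        eNorm p fun s : Star a => u s * (slab c (F (parent G a s)) (F s) / (c / 2)) := by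
  obtain ⟨K, hK, L, hL, hge, hout⟩ := exists_maxSubtree_level hG hF (hFa.trans_lt hc)
  set b : Star a → ℝ := fun s => u s * (slab c (F (parent G a s)) (F s) / (c / 2))
  set D := boundary G a K ∪ L
  have hslab (s : Star a) : 0 ≤ slab c (F (parent G a s)) (F s) :=
    slab_nonneg hc (hF _ _ (isParent_parent hG s.2).2)
  have hadm : ∀ t ∈ D, ∑' s : {s : Star a // Le G a s t}, |b s| * (u s)⁻¹ = 1 := by
    intro t ht
    have h0 := pathSum_sub_parent (a := a) hG
      (φ := fun t => (min (F t) c - min (F t) (c / 2)) / (c / 2))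
      (by simp [hFa, hc.le, (half_pos hc).le]) t
    have h1 : (min (F t) c - min (F t) (c / 2)) / (c / 2) = 1 := by
      have := hge t ht
      rw [min_eq_right this, min_eq_right (by linarith), sub_half, div_self (by positivity)]
    rw [← h1, ← h0]
    refine tsum_congr fun s => ?_
    have hb : 0 ≤ b s := mul_nonneg (hu s).le (div_nonneg (hslab s) (by positivity))
    rw [abs_of_nonneg hb, mul_comm, inv_mul_cancel_left₀ (hu s).ne', slab, sub_div]
  have hα : alpha G a p u D ≤ eNorm p b := iInf₂_le b hadm
  have hratio : ratio G a p u v K D ≤ constBLeaf G a p u v :=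
    le_iSup₂_of_le K hK (le_iSup₂_of_le (f := fun L _ => ratio G a p u v K (boundary G a K ∪ L))
      L hL le_rfl)
  have hsub : eNorm p (fun t : {t : Star a // c ≤ F t} => v t) ≤
      eNorm p (fun t : {t : Star a // (t : V) ∉ K \ D} => v t) := by
    unfold eNorm
    gcongr
    exact ENNReal.tsum_comp_le_tsum_of_injective
      (f := fun t : {t : Star a // c ≤ F t} =>
        (⟨t.1, hout _ t.2⟩ : {t : Star a // (t : V) ∉ K \ D}))
      (fun s t h => Subtype.ext (congrArg (fun r => r.1) h)) fun t => ‖v t‖ₑ ^ p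
  refine hsub.trans ?_
  exact ((ENNReal.div_le_iff_le_mul (Or.inr hB.ne)
    (Or.inl (ne_top_of_le_ne_top hfin hα))).1 hratio).trans (by gcongr)

/-- The upper bound. The vertices are grouped by the dyadic size `2 ^ k ≤ F < 2 ^ (k + 1)` of the
path sums `F`, each group is estimated by `tsum_level_le`, and the right-hand sides add up because
the slabs decompose the increments of `F`. -/
theorem pathSumBound_of_constBLeaf (hG : G.IsTree) (hp : 1 ≤ p) (hu : ∀ t, 0 < u t)
    (hB : constBLeaf G a p u v < ∞) : PathSumBound G a p u v (4 * constBLeaf G a p u v) := by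
  have hp0 : 0 < p := one_pos.trans_le hp
  intro f hf hfin
  set B := constBLeaf G a p u v
  set F := pathSum G a (fun s => f s * (u s)⁻¹) with hFdef
  have hg (s : Star a) : 0 ≤ f s * (u s)⁻¹ := mul_nonneg (hf s) (inv_nonneg.2 (hu s).le)
  have hF : ∀ s t, Le G a s t → F s ≤ F t := fun s t => pathSum_mono hG hg
  have hFa : F a = 0 := pathSum_root hG _
  have hF0 (t : V) : 0 ≤ F t := pathSum_nonneg hg t
  have hstep (s : Star a) : F s - F (parent G a s) = f s * (u s)⁻¹ := by
    rw [hFdef, pathSum_eq_add hG _ s.2]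
    ring
  -- `σ k s` is the part of the increment of `F` at `s` between the levels `2 ^ (k - 1)` and `2 ^ k`.
  let σ (k : ℤ) (s : Star a) : ℝ := slab (2 ^ k) (F (parent G a s)) (F s)
  have hσ (s : Star a) : ‖u s‖ₑ * ∑' k, ‖σ k s‖ₑ ≤ ‖f s‖ₑ := by
    have h1 := tsum_enorm_slab_le (hF _ _ (isParent_parent hG s.2).2)
    rw [hstep, ← Real.enorm_of_nonneg (hg s)] at h1
    calc ‖u s‖ₑ * ∑' k, ‖σ k s‖ₑ ≤ ‖u s‖ₑ * ‖f s * (u s)⁻¹‖ₑ := by gcongr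
      _ = ‖f s‖ₑ := by rw [← enorm_mul, mul_comm, inv_mul_cancel_right₀ (hu s).ne']
  have hb (k : ℤ) (s : Star a) :
      ‖u s * (σ k s / (2 ^ k / 2))‖ₑ = ‖((2 : ℝ) ^ k / 2)⁻¹‖ₑ * (‖u s‖ₑ * ‖σ k s‖ₑ) := by
    rw [div_eq_mul_inv, enorm_mul, enorm_mul]
    ring
  have hbfin (k : ℤ) : eNorm p (fun s : Star a => u s * (σ k s / (2 ^ k / 2))) ≠ ∞ := by
    simp only [eNorm_eq_lpNorm, hb, lpNorm_const_mul hp0]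
    refine ENNReal.mul_ne_top enorm_ne_top (ne_top_of_le_ne_top hfin ?_)
    refine lpNorm_mono hp0 fun s => le_trans ?_ (hσ s)
    gcongr
    exact ENNReal.le_tsum k
  have hscale (k : ℤ) : ‖(2 : ℝ) ^ (k + 1)‖ₑ * ‖((2 : ℝ) ^ k / 2)⁻¹‖ₑ = 4 := by
    have h2 : (2 : ℝ) ^ (k + 1) * ((2 : ℝ) ^ k / 2)⁻¹ = 4 := by
      have : (2 : ℝ) ^ k ≠ 0 := by positivity
      rw [zpow_add_one₀ two_ne_zero]
      field_simp
      norm_num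
    rw [← enorm_mul, h2, Real.enorm_of_nonneg (by norm_num)]
    simp
  have hlevel (k : ℤ) :
      ∑' t : Star a, {t : Star a | 2 ^ k ≤ F t}.indicator
          (fun t => (‖(2 : ℝ) ^ (k + 1)‖ₑ * ‖v t‖ₑ) ^ p) t ≤
        ∑' s, (4 * B * ‖u s‖ₑ) ^ p * ‖σ k s‖ₑ ^ p := by
    have h1 := tsum_level_le (v := v) hG hp0 hu hB hF hFa (zpow_pos two_pos k) (hbfin k)
    calc _ = (‖(2 : ℝ) ^ (k + 1)‖ₑ *
            eNorm p fun t : {t : Star a // 2 ^ k ≤ F t} => v t) ^ p := by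
          rw [← tsum_subtype {t : Star a | 2 ^ k ≤ F t}, eNorm_eq_lpNorm,
            ← lpNorm_const_mul hp0, lpNorm_rpow hp0]
          rfl
      _ ≤ (‖(2 : ℝ) ^ (k + 1)‖ₑ *
            (B * eNorm p fun s : Star a => u s * (σ k s / (2 ^ k / 2)))) ^ p := by gcongr
      _ = _ := by
          rw [eNorm_eq_lpNorm, ← lpNorm_const_mul hp0, ← lpNorm_const_mul hp0, lpNorm_rpow hp0]
          refine tsum_congr fun s => ?_
          rw [hb, ← ENNReal.mul_rpow_of_nonneg _ _ hp0.le, ← hscale k]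
          congr 1
          ring
  have hdyadic (t : Star a) : ‖v t * F t‖ₑ ^ p ≤ ∑' k : ℤ, {t : Star a | 2 ^ k ≤ F t}.indicator
      (fun t => (‖(2 : ℝ) ^ (k + 1)‖ₑ * ‖v t‖ₑ) ^ p) t := by
    rcases (hF0 t).eq_or_lt with h0 | h0
    · simp [← h0, hp0]
    · obtain ⟨k, hk⟩ := exists_mem_Ico_zpow h0 one_lt_two
      refine le_trans ?_ (ENNReal.le_tsum k)
      rw [Set.indicator_of_mem (show t ∈ {t : Star a | 2 ^ k ≤ F t} from hk.1), enorm_mul,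
        mul_comm ‖v t‖ₑ]
      gcongr
      rw [Real.enorm_of_nonneg (hF0 t), Real.enorm_of_nonneg (by positivity)]
      exact ENNReal.ofReal_le_ofReal hk.2.le
  rw [← ENNReal.rpow_le_rpow_iff hp0]
  calc eNorm p (fun t : Star a => v t * F t) ^ p
      = ∑' t : Star a, ‖v t * F t‖ₑ ^ p := lpNorm_rpow hp0 _
    _ ≤ ∑' (t : Star a) (k : ℤ), {t : Star a | 2 ^ k ≤ F t}.indicator
          (fun t => (‖(2 : ℝ) ^ (k + 1)‖ₑ * ‖v t‖ₑ) ^ p) t := ENNReal.tsum_le_tsum hdyadic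
    _ ≤ ∑' (k : ℤ) (s : Star a), (4 * B * ‖u s‖ₑ) ^ p * ‖σ k s‖ₑ ^ p := by
        rw [ENNReal.tsum_comm]
        exact ENNReal.tsum_le_tsum hlevel
    _ ≤ ∑' s : Star a, (4 * B * ‖f s‖ₑ) ^ p := by
        rw [ENNReal.tsum_comm]
        refine ENNReal.tsum_le_tsum fun s => ?_
        rw [ENNReal.tsum_mul_left]
        calc _ ≤ (4 * B * ‖u s‖ₑ) ^ p * (∑' k, ‖σ k s‖ₑ) ^ p := by
              gcongr
              exact tsum_rpow_le_rpow_tsum hp _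
          _ = (4 * B * (‖u s‖ₑ * ∑' k, ‖σ k s‖ₑ)) ^ p := by
              rw [← ENNReal.mul_rpow_of_nonneg _ _ hp0.le, mul_assoc]
          _ ≤ _ := by
              gcongr
              exact hσ s
    _ = (4 * B * eNorm p f) ^ p := by
        rw [eNorm_eq_lpNorm, ← lpNorm_const_mul hp0, lpNorm_rpow hp0]

/-! ### The best constant -/

/-- The admissible constants form a closed set, so there is a smallest one if there is any. -/
theorem exists_isLeast_hardyWith (hG : G.IsTree) (hpq : p.HolderConjugate q)
    (hu : ∀ t, 0 < u t) (hv : ∀ t, 0 < v t) (h : ∃ C : ℝ≥0, HardyWith G a q u v C) :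
    ∃ C : ℝ≥0, IsLeast {C : ℝ≥0 | HardyWith G a q u v C} C := by
  simp only [hardyWith_iff_pathSumBound hG hpq hu hv] at h ⊢
  have hclosed : IsClosed {C : ℝ≥0 | PathSumBound G a p u v C} := by
    simp only [PathSumBound, Set.ofPred_forall]
    refine isClosed_iInter fun f => isClosed_iInter fun _ => isClosed_iInter fun hf => ?_
    exact isClosed_le continuous_const
      ((ENNReal.continuous_mul_const hf).comp ENNReal.continuous_coe)
  exact ⟨_, hclosed.csInf_mem h (OrderBot.bddBelow _),
    fun C hC => csInf_le (OrderBot.bddBelow _) hC⟩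

theorem hardyWith_characterization (hG : G.IsTree) (hpq : p.HolderConjugate q)
    (hu : ∀ t, 0 < u t) (hv : ∀ t, 0 < v t) :
    ((∃ C : ℝ≥0, HardyWith G a q u v C) ↔ constBLeaf G a p u v < ∞) ∧
      (constBLeaf G a p u v < ∞ →
        ∃ C : ℝ≥0, IsLeast {C : ℝ≥0 | HardyWith G a q u v C} C ∧
          constBLeaf G a p u v ≤ C ∧ (C : ℝ≥0∞) ≤ 4 * constBLeaf G a p u v) := by
  have lower {C : ℝ≥0} (hC : HardyWith G a q u v C) : constBLeaf G a p u v ≤ C :=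
    constBLeaf_le_of_pathSumBound hG hpq.pos hu (pathSumBound_of_hardyWith hG hpq hu hv hC)
  have upper (hB : constBLeaf G a p u v < ∞) :
      ∃ C : ℝ≥0, HardyWith G a q u v C ∧ (C : ℝ≥0∞) = 4 * constBLeaf G a p u v := by
    have hcoe : (((4 * constBLeaf G a p u v).toNNReal : ℝ≥0) : ℝ≥0∞) =
        4 * constBLeaf G a p u v :=
      ENNReal.coe_toNNReal (ENNReal.mul_ne_top (by simp) hB.ne)
    refine ⟨_, hardyWith_of_pathSumBound hG hpq hu hv ?_, hcoe⟩
    rw [hcoe]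
    exact pathSumBound_of_constBLeaf hG hpq.lt.le hu hB
  refine ⟨⟨fun ⟨C, hC⟩ => (lower hC).trans_lt ENNReal.coe_lt_top, fun hB => ?_⟩, fun hB => ?_⟩
  · obtain ⟨C, hC, -⟩ := upper hB
    exact ⟨C, hC⟩
  · obtain ⟨C', hC', hC'eq⟩ := upper hB
    obtain ⟨C, hC⟩ := exists_isLeast_hardyWith hG hpq hu hv ⟨C', hC'⟩
    exact ⟨C, hC, lower hC.1, hC'eq ▸ ENNReal.coe_le_coe.2 (hC.2 hC')⟩

theorem constBLeaf_eq_constB (h : ∀ s : V, ¬ IsLeaf G a s) :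
    constBLeaf G a p u v = constB G a p u v := by
  refine iSup_congr fun K => iSup_congr fun _ => le_antisymm (iSup₂_le fun L hL => ?_)
    (le_iSup₂_of_le ∅ ⟨Set.empty_subset _, fun s hs => hs.elim⟩ (by rw [Set.union_empty]))
  rw [Set.eq_empty_of_forall_notMem fun s hs => h s (hL.2 s hs), Set.union_empty]

end Bounds

end

end TreeHardy

theorem mainTheorem10 {V : Type*} (G : SimpleGraph V) (hG : G.IsTree) (a : V)
    (hfin : ∀ s : V, {t : V | TreeHardy.IsParent G a s t}.Finite)
    (p q : ℝ) (hpq : p.HolderConjugate q)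
    (u v : TreeHardy.Star a → ℝ) (hu : ∀ t, 0 < u t) (hv : ∀ t, 0 < v t) :
    (((∃ C : ℝ≥0, TreeHardy.HardyWith G a q u v C) ↔ TreeHardy.constBLeaf G a p u v < ∞) ∧
      (TreeHardy.constBLeaf G a p u v < ∞ →
        ∃ C : ℝ≥0, IsLeast {C : ℝ≥0 | TreeHardy.HardyWith G a q u v C} C ∧
          TreeHardy.constBLeaf G a p u v ≤ C ∧ (C : ℝ≥0∞) ≤ 4 * TreeHardy.constBLeaf G a p u v)) ∧
    ((∀ s : V, ¬ TreeHardy.IsLeaf G a s) →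
      ((∃ C : ℝ≥0, TreeHardy.HardyWith G a q u v C) ↔ TreeHardy.constB G a p u v < ∞) ∧
      (TreeHardy.constB G a p u v < ∞ →
        ∃ C : ℝ≥0, IsLeast {C : ℝ≥0 | TreeHardy.HardyWith G a q u v C} C ∧
          TreeHardy.constB G a p u v ≤ C ∧ (C : ℝ≥0∞) ≤ 4 * TreeHardy.constB G a p u v)) := by
  have key := TreeHardy.hardyWith_characterization (a := a) hG hpq hu hv
  refine ⟨key, fun hleaf => ?_⟩
  rwa [TreeHardy.constBLeaf_eq_constB hleaf] at key
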